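/- For each sample size $n$ let $d_n,K_n\in\mathbb N$, let $X=X_n\in\mathbb R^{n\times d_n}$ be a non-random design with rows $x_1,\dots,x_n$, let $\beta^*=\beta^*_n\in\mathbb R^{d_n}$ with active set $S^*=\{j:\beta^*_j\neq0\}$, and let $y_1,\dots,y_n$ be independent $\{0,1\}$-valued random variables with $P(y_i=1)=\psi'(x_i^\top\beta^*)$, where $\psi(t)=\log(1+e^t)$. For $S\subseteq\{1,\dots,d_n\}$ let $x_{S,i}$ and $\beta^*_S$ be the subvectors with coordinates in $S$. Let $\mathcal S_n$ be a (non-random) family of sets $S\supseteq S^*$ with $|S|=K_n$, and suppose that there are constants $M$, $0<C_1<C_2<\infty$ and $\xi<\tilde\xi<\infty$ such that for all large $n$ and all $S\in\mathcal S_n$: (C1) $\max_i\|x_{S,i}\|\le M\sqrt{K_n}$, and all eigenvalues of $\Xi_{S,n}=\frac1n\sum_{i=1}^n x_{S,i}x_{S,i}^\top$ lie in $(C_1,C_2)$; (C2) $\max_i|x_{S,i}^\top\beta^*_S|<\xi$, and the parameter space is $\mathcal B_S=\{b\in\mathbb R^S:\max_i|x_{S,i}^\top b|<\tilde\xi\}$;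 (C3) $K_n^3/n\to0$. Let $\hat\beta_S$ be a maximum likelihood estimator on $S$, i.e. a random vector that maximizes $\ell_n(b)=\sum_{i=1}^n\{y_ix_{S,i}^\top b-\psi(x_{S,i}^\top b)\}$ over $b\in\mathcal B_S$ whenever a maximizer exists (and is arbitrary otherwise). Put $s_n=\frac1{\sqrt n}\sum_{i=1}^n x_{S,i}(y_i-\psi'(x_{S,i}^\top\beta^*_S))$, $\Sigma_n=\frac1n\sum_{i=1}^n\psi''(x_{S,i}^\top\beta^*_S)x_{S,i}x_{S,i}^\top$ and, for $\eta\in\mathbb R^S$, $\sigma_n^2=\eta^\top\Sigma_n^{-1}\eta$. Then: (i) $\sqrt n\,\sigma_n^{-1}\eta^\top(\hat\beta_S-\beta^*_S)=\sigma_n^{-1}\eta^\top\Sigma_n^{-1}s_n+r_n(\eta,S)$, where $r_n(\eta,S)\to0$ in probability uniformly in $\eta$ and $S$: for every $\varepsilon>0$, $$\sup_{S\in\mathcal S_n}P\bigl(\exists\,\eta\in\mathbb R^S\setminus\{0\}:\ |r_n(\eta,S)|>\varepsilon\bigr)\to0$$ (outer probability); (ii) for all sequences $S_n\in\mathcal S_n$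 and $\eta_n\in\mathbb R^{S_n}\setminus\{0\}$ (for all large $n$), $\sqrt n\,\sigma_n^{-1}\eta_n^\top(\hat\beta_{S_n}-\beta^*_{S_n})$ converges in distribution to $N(0,1)$. -/

import Mathlib

open MeasureTheory ProbabilityTheory Filter Topology

noncomputable section

namespace LogisticMLE

/-- The cumulant generating function `ψ(t) = log (1 + exp t)` of the Bernoulli model. -/
def psi (t : ℝ) : ℝ := Real.log (1 + Real.exp t)

variable {n d : ℕ}

/-- The `i`-th row of the design restricted to the coordinates in `S`. -/
def subRow (X : Matrix (Fin n) (Fin d) ℝ) (S : Finset (Fin d)) (i : Fin n) : S → ℝ :=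
  fun j => X i j

/-- The subvector of `v` with coordinates in `S`. -/
def subVec (v : Fin d → ℝ) (S : Finset (Fin d)) : S → ℝ :=
  fun j => v j

/-- The log-likelihood `∑ i, (y i * ⟨x_{S,i}, b⟩ - ψ ⟨x_{S,i}, b⟩)` of the submodel `S`. -/
def logLik (X : Matrix (Fin n) (Fin d) ℝ) (S : Finset (Fin d)) (y : Fin n → ℝ)
    (b : S → ℝ) : ℝ :=
  ∑ i, (y i * (subRow X S i ⬝ᵥ b) - psi (subRow X S i ⬝ᵥ b))

/-- The parameter space: all linear predictors are smaller than `r` in absolute value. -/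
def paramSpace (X : Matrix (Fin n) (Fin d) ℝ) (S : Finset (Fin d)) (r : ℝ) : Set (S → ℝ) :=
  {b | ∀ i, |subRow X S i ⬝ᵥ b| < r}

/-- `b` is a maximum likelihood estimate in the submodel `S`: it lies in the parameter space
and maximizes the log-likelihood there. -/
def IsMLE (X : Matrix (Fin n) (Fin d) ℝ) (S : Finset (Fin d)) (r : ℝ) (y : Fin n → ℝ)
    (b : S → ℝ) : Prop :=
  b ∈ paramSpace X S r ∧ IsMaxOn (logLik X S y) (paramSpace X S r) b

/-- The Gram matrix `n⁻¹ ∑ i, x_{S,i} x_{S,i}ᵀ`. -/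
def gram (X : Matrix (Fin n) (Fin d) ℝ) (S : Finset (Fin d)) : Matrix S S ℝ :=
  (n : ℝ)⁻¹ • ∑ i, Matrix.vecMulVec (subRow X S i) (subRow X S i)

/-- The normalized score `n^{-1/2} ∑ i, (y i - ψ' ⟨x_{S,i}, b⟩) x_{S,i}`. -/
def score (X : Matrix (Fin n) (Fin d) ℝ) (S : Finset (Fin d)) (y : Fin n → ℝ)
    (b : S → ℝ) : S → ℝ :=
  (Real.sqrt n)⁻¹ • ∑ i, (y i - deriv psi (subRow X S i ⬝ᵥ b)) • subRow X S i

/-- The information matrix `n⁻¹ ∑ i, ψ'' ⟨x_{S,i}, b⟩ x_{S,i} x_{S,i}ᵀ`. -/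
def info (X : Matrix (Fin n) (Fin d) ℝ) (S : Finset (Fin d)) (b : S → ℝ) : Matrix S S ℝ :=
  (n : ℝ)⁻¹ • ∑ i, deriv (deriv psi) (subRow X S i ⬝ᵥ b) •
    Matrix.vecMulVec (subRow X S i) (subRow X S i)

/-- `σ = (ηᵀ Σ⁻¹ η)^{1/2}`, with `Σ` the information matrix at the parameter `b`. -/
def sigma (X : Matrix (Fin n) (Fin d) ℝ) (S : Finset (Fin d)) (b η : S → ℝ) : ℝ :=
  Real.sqrt (η ⬝ᵥ ((info X S b)⁻¹).mulVec η)

/-- The standardized estimation error `√n σ⁻¹ ηᵀ (b' - b)` of the estimate `b'`. -/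
def stdError (X : Matrix (Fin n) (Fin d) ℝ) (S : Finset (Fin d)) (b η b' : S → ℝ) : ℝ :=
  Real.sqrt n * (sigma X S b η)⁻¹ * (η ⬝ᵥ (b' - b))

/-- The linear term `σ⁻¹ ηᵀ Σ⁻¹ s`, with `s` the score at `b`. -/
def linTerm (X : Matrix (Fin n) (Fin d) ℝ) (S : Finset (Fin d)) (b η : S → ℝ)
    (y : Fin n → ℝ) : ℝ :=
  (sigma X S b η)⁻¹ * (η ⬝ᵥ ((info X S b)⁻¹).mulVec (score X S y b))

/-- Row norms at most `M √|S|`, and all eigenvalues of the Gram matrix in `(C₁, C₂)`. -/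
structure DesignCondition (X : Matrix (Fin n) (Fin d) ℝ) (S : Finset (Fin d))
    (M C₁ C₂ : ℝ) : Prop where
  row_norm : ∀ i, ‖WithLp.toLp 2 (subRow X S i)‖ ≤ M * Real.sqrt S.card
  eigenvalue : ∀ l ∈ spectrum ℝ (gram X S), C₁ < l ∧ l < C₂

/-- The logistic regression model with fixed design `X` and true coefficient vector `β`:
independent `{0,1}`-valued responses with `P(y i = 1) = ψ' ⟨x_i, β⟩`. -/
structure IsLogisticModel {Ω : Type*} [MeasurableSpace Ω] (μ : Measure Ω)
    (X : Matrix (Fin n) (Fin d) ℝ) (β : Fin d → ℝ) (y : Fin n → Ω → ℝ) : Prop where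
  measurable : ∀ i, Measurable (y i)
  binary : ∀ i ω, y i ω = 0 ∨ y i ω = 1
  indep : iIndepFun y μ
  prob : ∀ i, μ.real {ω | y i ω = 1} = deriv psi (X i ⬝ᵥ β)

end LogisticMLE

end

/-!
Fix a submodel `S` and write `b₀` for the true parameter, `δ = b - b₀` for the error of an
estimate, `s` for the normalized score and `Σ` for the information matrix at `b₀`.

*Consistency.* On the parameter space all linear predictors are bounded by `ξ'`, so `ψ''` is bounded
below there by a constant `c = curvature ξ'`, and the log-likelihood is strongly concave. A point of
the parameter space at least as likely as `b₀` therefore satisfies `‖δ‖² ≤ 4 ‖s‖² / (c² C₁² n)`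
(`sq_dist_le_of_logLik_le`). Since `E ‖s‖² ≤ M² |S|`, Markov's inequality gives `‖s‖² ≤ L |S|` up to
small probability (`IsLogisticModel.measureReal_score_le`). On this event the ball of radius
`O(√(|S| / n))` lies in the parameter space once `|S|² / n` is small, so by compactness a maximizer
exists (`exists_isMLE_of_score_le`). It satisfies the likelihood equations because the parameter
space is open.

*Linearization.* Substituting `η = Σ u` turns the remainder into `(uᵀ Σ u)^{-1/2} uᵀ (√n Σ δ - s)`.
By the likelihood equations and a second order Taylor bound, `uᵀ (√n Σ δ - s)` is at most
`n^{-1/2} ∑ (xᵢᵀ δ)² |xᵢᵀ u|`. Bounding one factor `|xᵢᵀ δ|` by `|M| √|S| ‖δ‖` and applying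
Cauchy-Schwarz to the other two shows that the remainder is `O(√n √|S| ‖δ‖²) = O(√(|S|³ / n))`
uniformly in `η` (`IsMLE.abs_stdError_sub_linTerm_le`).

*Normality.* The linear term is a sum of independent centered variables of total variance `1`, each
`O(√(|S| / n))`, so its characteristic function converges to that of the standard Gaussian law
(`IsLogisticModel.norm_charFun_linTerm_sub_le`). The remainder is removed by Slutsky's lemma for
characteristic functions, which allows the probability space to vary with `n`
(`tendstoInDistribution_of_charFun_of_sub`).
-/

namespace LogisticMLE

/-! ### The cumulant generating function -/

lemma hasDerivAt_psi (t : ℝ) : HasDerivAt psi (Real.sigmoid t) t := by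
  have h := ((Real.hasDerivAt_exp t).const_add 1).log (by positivity)
  convert! h using 1
  rw [Real.sigmoid_def, Real.exp_neg]
  have := Real.exp_pos t
  field_simp
  ring

lemma deriv_psi : deriv psi = Real.sigmoid :=
  funext fun t => (hasDerivAt_psi t).deriv

lemma deriv_deriv_psi : deriv (deriv psi) = fun t => Real.sigmoid t * (1 - Real.sigmoid t) := by
  rw [deriv_psi, Real.deriv_sigmoid]

/-- A lower bound for `ψ''` on `[-r, r]`: there `ψ'' t = σ(t) σ(-t)`, with both factors at least
`σ(-r)`, where `σ` is the sigmoid function. -/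
noncomputable def curvature (r : ℝ) : ℝ := Real.sigmoid (-r) ^ 2

lemma curvature_pos (r : ℝ) : 0 < curvature r := pow_pos (Real.sigmoid_pos _) 2

lemma curvature_le_deriv_deriv_psi {r t : ℝ} (ht : |t| ≤ r) :
    curvature r ≤ Real.sigmoid t * (1 - Real.sigmoid t) := by
  rw [abs_le] at ht
  rw [← Real.sigmoid_neg, curvature, sq]
  exact mul_le_mul (Real.sigmoid_le ht.1) (Real.sigmoid_le (by linarith))
    (Real.sigmoid_nonneg _) (Real.sigmoid_nonneg _)

lemma hasDerivAt_sigmoid_sub_mul (c t : ℝ) :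
    HasDerivAt (fun t => Real.sigmoid t - c * t) (Real.sigmoid t * (1 - Real.sigmoid t) - c) t := by
  convert! (Real.hasDerivAt_sigmoid t).sub ((hasDerivAt_id t).const_mul c) using 1
  simp

/-- Strong convexity of `ψ` on bounded intervals. -/
lemma psi_tangent_add_le {r a b : ℝ} (ha : |a| ≤ r) (hb : |b| ≤ r) :
    psi a + Real.sigmoid a * (b - a) + curvature r / 2 * (b - a) ^ 2 ≤ psi b := by
  set g : ℝ → ℝ := fun t => psi t - curvature r / 2 * t ^ 2 with hg
  have hg' : ∀ t, HasDerivAt g (Real.sigmoid t - curvature r * t) t := fun t => by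
    convert! (hasDerivAt_psi t).sub ((hasDerivAt_pow 2 t).const_mul (curvature r / 2)) using 1
    push_cast
    ring
  have hg'' : ∀ t, HasDerivAt (fun t => Real.sigmoid t - curvature r * t)
      (Real.sigmoid t * (1 - Real.sigmoid t) - curvature r) t :=
    fun t => hasDerivAt_sigmoid_sub_mul _ t
  have hconv : ConvexOn ℝ (Set.Icc (-r) r) g := by
    refine convexOn_of_hasDerivWithinAt2_nonneg (convex_Icc _ _)
      (fun t _ => (hg' t).continuousAt.continuousWithinAt)
      (fun t _ => (hg' t).hasDerivWithinAt) (fun t _ => (hg'' t).hasDerivWithinAt)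
      (fun t ht => ?_)
    have := curvature_le_deriv_deriv_psi (abs_le.2 (Set.mem_Icc.1 (interior_subset ht)))
    linarith
  have key : g a + (Real.sigmoid a - curvature r * a) * (b - a) ≤ g b := by
    rcases lt_trichotomy a b with h | h | h
    · have := hconv.le_slope_of_hasDerivAt (abs_le.1 ha) (abs_le.1 hb) h (hg' a)
      rw [slope_def_field, le_div_iff₀ (by linarith)] at this
      linarith
    · simp [h]
    · have := hconv.slope_le_of_hasDerivAt (abs_le.1 hb) (abs_le.1 ha) h (hg' a)
      rw [slope_def_field, div_le_iff₀ (by linarith)] at this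
      linarith
  simp only [hg] at key
  nlinarith [key]

lemma abs_sigmoid_sub_le (a b : ℝ) : |Real.sigmoid b - Real.sigmoid a| ≤ |b - a| := by
  have := Convex.norm_image_sub_le_of_norm_hasDerivWithin_le (f := Real.sigmoid) (C := 1)
    (s := Set.univ) (x := a) (y := b)
    (fun t _ => (Real.hasDerivAt_sigmoid t).hasDerivWithinAt) (fun t _ => ?_) convex_univ
    trivial trivial
  · simpa using this
  · have h0 := Real.sigmoid_nonneg t
    have h1 := Real.sigmoid_le_one t
    rw [Real.norm_eq_abs, abs_le]
    constructor <;> nlinarith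

/-- First order Taylor expansion of `ψ'`: a mean value argument, with `ψ''` `1`-Lipschitz. -/
lemma abs_sigmoid_taylor_le (a b : ℝ) :
    |Real.sigmoid b - Real.sigmoid a - Real.sigmoid a * (1 - Real.sigmoid a) * (b - a)|
      ≤ (b - a) ^ 2 := by
  have := Convex.norm_image_sub_le_of_norm_hasDerivWithin_le
    (f := fun t => Real.sigmoid t - Real.sigmoid a * (1 - Real.sigmoid a) * t) (C := |b - a|)
    (f' := fun t => Real.sigmoid t * (1 - Real.sigmoid t)
      - Real.sigmoid a * (1 - Real.sigmoid a))
    (s := Set.uIcc a b) (x := a) (y := b)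
    (fun t _ => (hasDerivAt_sigmoid_sub_mul _ t).hasDerivWithinAt)
    (fun t ht => ?_) (convex_uIcc a b) Set.left_mem_uIcc Set.right_mem_uIcc
  · rw [Real.norm_eq_abs, Real.norm_eq_abs, ← sq, sq_abs] at this
    convert this using 2
    ring
  · have h := (abs_sigmoid_sub_le a t).trans (Set.abs_sub_left_of_mem_uIcc ht)
    refine le_trans ?_ h
    have e : Real.sigmoid t * (1 - Real.sigmoid t) - Real.sigmoid a * (1 - Real.sigmoid a)
        = (Real.sigmoid t - Real.sigmoid a) * (1 - Real.sigmoid t - Real.sigmoid a) := by ring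
    rw [e, Real.norm_eq_abs, abs_mul]
    refine mul_le_of_le_one_right (abs_nonneg _) ?_
    have h0 := Real.sigmoid_nonneg t
    have h1 := Real.sigmoid_le_one t
    have h2 := Real.sigmoid_nonneg a
    have h3 := Real.sigmoid_le_one a
    rw [abs_le]
    constructor <;> linarith

/-! ### Quadratic forms of the design -/

section Design

variable {n d : ℕ} {X : Matrix (Fin n) (Fin d) ℝ} {S : Finset (Fin d)}

lemma mulVec_smul_sum_vecMulVec {m : Type*} [Fintype m] (a : ℝ) (w : Fin n → ℝ)
    (x : Fin n → m → ℝ) (u v : m → ℝ) :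
    u ⬝ᵥ (a • ∑ i, w i • Matrix.vecMulVec (x i) (x i)).mulVec v
      = a * ∑ i, w i * (x i ⬝ᵥ u) * (x i ⬝ᵥ v) := by
  rw [Matrix.smul_mulVec, dotProduct_smul, Matrix.sum_mulVec, dotProduct_sum, smul_eq_mul]
  congr 1
  refine Finset.sum_congr rfl fun i _ => ?_
  rw [Matrix.smul_mulVec, dotProduct_smul, Matrix.vecMulVec_mulVec, dotProduct_smul,
    dotProduct_comm u]
  simp [mul_comm, mul_left_comm]

lemma dotProduct_gram_mulVec (u v : S → ℝ) :
    u ⬝ᵥ (gram X S).mulVec v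
      = (n : ℝ)⁻¹ * ∑ i, (subRow X S i ⬝ᵥ u) * (subRow X S i ⬝ᵥ v) := by
  simpa [gram] using mulVec_smul_sum_vecMulVec (n : ℝ)⁻¹ (fun _ => 1) (subRow X S) u v

lemma dotProduct_info_mulVec (b u v : S → ℝ) :
    u ⬝ᵥ (info X S b).mulVec v
      = (n : ℝ)⁻¹ * ∑ i, deriv (deriv psi) (subRow X S i ⬝ᵥ b) *
        (subRow X S i ⬝ᵥ u) * (subRow X S i ⬝ᵥ v) :=
  mulVec_smul_sum_vecMulVec _ _ _ u v

lemma isHermitian_of_dotProduct_comm {m : Type*} [Fintype m] [DecidableEq m] {A : Matrix m m ℝ}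
    (h : ∀ u v : m → ℝ, u ⬝ᵥ A.mulVec v = v ⬝ᵥ A.mulVec u) : A.IsHermitian := by
  ext i j
  simpa [Matrix.mulVec_single, single_dotProduct] using h (Pi.single j 1) (Pi.single i 1)

lemma gram_isHermitian : (gram X S).IsHermitian :=
  isHermitian_of_dotProduct_comm fun u v => by
    simp_rw [dotProduct_gram_mulVec, mul_comm]

lemma info_isHermitian (b : S → ℝ) : (info X S b).IsHermitian :=
  isHermitian_of_dotProduct_comm fun u v => by
    simp_rw [dotProduct_info_mulVec, mul_assoc, mul_comm (subRow X S _ ⬝ᵥ u)]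

variable {M C₁ C₂ : ℝ}

lemma DesignCondition.le_gram (h : DesignCondition X S M C₁ C₂) (u : S → ℝ) :
    C₁ * (u ⬝ᵥ u) ≤ u ⬝ᵥ (gram X S).mulVec u := by
  have hps : (gram X S - algebraMap ℝ (Matrix S S ℝ) C₁).PosSemidef := by
    rw [Matrix.posSemidef_iff_isHermitian_and_spectrum_nonneg, ← spectrum.sub_singleton_eq]
    refine ⟨gram_isHermitian.sub (by simp [Matrix.algebraMap_eq_diagonal]), ?_⟩
    rintro _ ⟨l, hl, _, rfl, rfl⟩
    exact sub_nonneg.2 (h.eigenvalue l hl).1.le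
  have := hps.dotProduct_mulVec_nonneg u
  simpa [Matrix.sub_mulVec, dotProduct_sub, Algebra.algebraMap_eq_smul_one,
    Matrix.smul_mulVec] using this

lemma DesignCondition.gram_le (h : DesignCondition X S M C₁ C₂) (u : S → ℝ) :
    u ⬝ᵥ (gram X S).mulVec u ≤ C₂ * (u ⬝ᵥ u) := by
  have hps : (algebraMap ℝ (Matrix S S ℝ) C₂ - gram X S).PosSemidef := by
    rw [Matrix.posSemidef_iff_isHermitian_and_spectrum_nonneg, ← spectrum.singleton_sub_eq]
    refine ⟨Matrix.IsHermitian.sub (by simp [Matrix.algebraMap_eq_diagonal]) gram_isHermitian, ?_⟩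
    rintro _ ⟨_, rfl, l, hl, rfl⟩
    exact sub_nonneg.2 (h.eigenvalue l hl).2.le
  have := hps.dotProduct_mulVec_nonneg u
  simpa [Matrix.sub_mulVec, dotProduct_sub, Algebra.algebraMap_eq_smul_one,
    Matrix.smul_mulVec] using this

lemma DesignCondition.row_dotProduct_self_le (h : DesignCondition X S M C₁ C₂) (i : Fin n) :
    subRow X S i ⬝ᵥ subRow X S i ≤ M ^ 2 * S.card := by
  have h1 := pow_le_pow_left₀ (norm_nonneg _) (h.row_norm i) 2
  rw [EuclideanSpace.real_norm_sq_eq, mul_pow, Real.sq_sqrt (Nat.cast_nonneg _)] at h1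
  simpa [dotProduct, sq] using h1

lemma sq_dotProduct_le {m : Type*} [Fintype m] (u v : m → ℝ) :
    (u ⬝ᵥ v) ^ 2 ≤ (u ⬝ᵥ u) * (v ⬝ᵥ v) := by
  simpa [dotProduct, sq] using Finset.sum_mul_sq_le_sq_mul_sq Finset.univ u v

lemma dotProduct_self_nonneg {m : Type*} [Fintype m] (u : m → ℝ) : 0 ≤ u ⬝ᵥ u :=
  Finset.sum_nonneg fun _ _ => mul_self_nonneg _

lemma DesignCondition.sq_row_dotProduct_le (h : DesignCondition X S M C₁ C₂) (i : Fin n)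
    (u : S → ℝ) : (subRow X S i ⬝ᵥ u) ^ 2 ≤ M ^ 2 * S.card * (u ⬝ᵥ u) :=
  (sq_dotProduct_le _ _).trans
    (mul_le_mul_of_nonneg_right (h.row_dotProduct_self_le i) (dotProduct_self_nonneg u))

lemma curvature_mul_gram_le_info {r : ℝ} {b : S → ℝ} (hb : ∀ i, |subRow X S i ⬝ᵥ b| ≤ r)
    (u : S → ℝ) :
    curvature r * (u ⬝ᵥ (gram X S).mulVec u) ≤ u ⬝ᵥ (info X S b).mulVec u := by
  rw [dotProduct_gram_mulVec, dotProduct_info_mulVec, mul_left_comm, Finset.mul_sum]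
  refine mul_le_mul_of_nonneg_left (Finset.sum_le_sum fun i _ => ?_) (by positivity)
  rw [mul_assoc, deriv_deriv_psi]
  exact mul_le_mul_of_nonneg_right (curvature_le_deriv_deriv_psi (hb i)) (mul_self_nonneg _)

lemma info_lower_bound {r : ℝ} {b : S → ℝ} (hC₁ : 0 < C₁) (h : DesignCondition X S M C₁ C₂)
    (hb : ∀ i, |subRow X S i ⬝ᵥ b| ≤ r) {u : S → ℝ}
    (hu : u ≠ 0) :
    0 < curvature r * C₁ * (u ⬝ᵥ u) ∧
      curvature r * C₁ * (u ⬝ᵥ u) ≤ u ⬝ᵥ (info X S b).mulVec u := by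
  have hu0 : 0 < u ⬝ᵥ u :=
    lt_of_le_of_ne (dotProduct_self_nonneg u) fun h => hu (dotProduct_self_eq_zero.1 h.symm)
  refine ⟨mul_pos (mul_pos (curvature_pos r) hC₁) hu0, ?_⟩
  have h1 := curvature_mul_gram_le_info hb u
  have h2 := mul_le_mul_of_nonneg_left (h.le_gram u) (curvature_pos r).le
  linarith

/-- The substitution `η = Σ u`, which removes the inverse of the information matrix `Σ`:
then `σ² = uᵀ Σ u` and `ηᵀ Σ⁻¹ s = uᵀ s`. -/
lemma exists_info_mulVec_eq {r : ℝ} {b : S → ℝ} (hC₁ : 0 < C₁)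
    (h : DesignCondition X S M C₁ C₂) (hb : ∀ i, |subRow X S i ⬝ᵥ b| ≤ r)
    {η : S → ℝ} (hη : η ≠ 0) :
    ∃ u : S → ℝ, u ≠ 0 ∧ (info X S b).mulVec u = η ∧
      sigma X S b η = Real.sqrt (u ⬝ᵥ (info X S b).mulVec u) ∧
      ∀ s : S → ℝ, η ⬝ᵥ ((info X S b)⁻¹).mulVec s = u ⬝ᵥ s := by
  have hpd : (info X S b).PosDef := by
    refine Matrix.PosDef.of_dotProduct_mulVec_pos (info_isHermitian b) fun u hu => ?_
    obtain ⟨h0, h1⟩ := info_lower_bound hC₁ h hb hu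
    exact h0.trans_le h1
  have hu : IsUnit (info X S b).det := (Matrix.isUnit_iff_isUnit_det _).1 hpd.isUnit
  have hinv : (info X S b).mulVec (((info X S b)⁻¹).mulVec η) = η := by
    rw [Matrix.mulVec_mulVec, Matrix.mul_nonsing_inv _ hu, Matrix.one_mulVec]
  have hsymm : ∀ s : S → ℝ, η ⬝ᵥ ((info X S b)⁻¹).mulVec s
      = ((info X S b)⁻¹).mulVec η ⬝ᵥ s := fun s => by
    rw [Matrix.dotProduct_mulVec, ← Matrix.mulVec_transpose]
    congr 2
    simpa using (info_isHermitian (X := X) b).inv.eq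
  refine ⟨((info X S b)⁻¹).mulVec η, fun h0 => hη ?_, hinv, ?_, hsymm⟩
  · rw [← hinv, h0, Matrix.mulVec_zero]
  · rw [hinv, sigma, dotProduct_comm]

end Design

/-! ### Deterministic bounds for the maximizer -/

section Maximizer

variable {n d : ℕ} {X : Matrix (Fin n) (Fin d) ℝ} {S : Finset (Fin d)} {M C₁ C₂ r : ℝ}
  {y : Fin n → ℝ} {b₀ b : S → ℝ}

lemma score_dotProduct (u : S → ℝ) :
    score X S y b ⬝ᵥ u
      = (Real.sqrt n)⁻¹ * ∑ i, (y i - Real.sigmoid (subRow X S i ⬝ᵥ b)) * (subRow X S i ⬝ᵥ u) := by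
  simp [score, smul_dotProduct, sum_dotProduct, deriv_psi]

lemma logLik_le (hn : 0 < n) (hb₀ : ∀ i, |subRow X S i ⬝ᵥ b₀| ≤ r)
    (hb : ∀ i, |subRow X S i ⬝ᵥ b| ≤ r) :
    logLik X S y b ≤ logLik X S y b₀ + Real.sqrt n * (score X S y b₀ ⬝ᵥ (b - b₀))
      - curvature r / 2 * (n * ((b - b₀) ⬝ᵥ (gram X S).mulVec (b - b₀))) := by
  have hn' : (0 : ℝ) < n := by exact_mod_cast hn
  rw [score_dotProduct, dotProduct_gram_mulVec, mul_inv_cancel_left₀ (by positivity),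
    mul_inv_cancel_left₀ (by positivity), logLik, logLik, Finset.mul_sum,
    ← Finset.sum_add_distrib, ← Finset.sum_sub_distrib]
  refine Finset.sum_le_sum fun i _ => ?_
  have := psi_tangent_add_le (hb₀ i) (hb i)
  rw [dotProduct_sub]
  linarith

/-- Every parameter at least as likely as `b₀` is close to `b₀`, by strong concavity of the
log-likelihood on the parameter space. -/
lemma sq_dist_le_of_logLik_le (hn : 0 < n) (hC₁ : 0 < C₁) (h : DesignCondition X S M C₁ C₂)
    (hb₀ : ∀ i, |subRow X S i ⬝ᵥ b₀| ≤ r) (hb : ∀ i, |subRow X S i ⬝ᵥ b| ≤ r)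
    (hle : logLik X S y b₀ ≤ logLik X S y b) :
    (curvature r * C₁) ^ 2 * n * ((b - b₀) ⬝ᵥ (b - b₀))
      ≤ 4 * (score X S y b₀ ⬝ᵥ score X S y b₀) := by
  have hn' : (0 : ℝ) < n := by exact_mod_cast hn
  have h1 := logLik_le (y := y) hn hb₀ hb
  have h2 := mul_le_mul_of_nonneg_left (h.le_gram (b - b₀))
    (mul_nonneg (curvature_pos r).le hn'.le)
  have hCS := sq_dotProduct_le (score X S y b₀) (b - b₀)
  have hs0 := dotProduct_self_nonneg (score X S y b₀)
  have hc := curvature_pos r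
  set N := (b - b₀) ⬝ᵥ (b - b₀) with hN
  set s := score X S y b₀ ⬝ᵥ (b - b₀)
  have hN0 : 0 ≤ N := dotProduct_self_nonneg _
  have hq : 0 < Real.sqrt n := Real.sqrt_pos.2 hn'
  have hqq : Real.sqrt n * Real.sqrt n = n := Real.mul_self_sqrt hn'.le
  have h3 : curvature r * C₁ * Real.sqrt n * N ≤ 2 * s := by
    refine le_of_mul_le_mul_left ?_ hq
    have : Real.sqrt n * (curvature r * C₁ * Real.sqrt n * N)
      = curvature r * C₁ * N * n := by linear_combination curvature r * C₁ * N * hqq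
    linarith
  rcases hN0.eq_or_lt with h0 | h0
  · rw [← h0]
    linarith
  · refine le_of_mul_le_mul_right ?_ h0
    have h4 := pow_le_pow_left₀ (by positivity) h3 2
    have : (curvature r * C₁ * Real.sqrt n * N) ^ 2
      = (curvature r * C₁) ^ 2 * n * N * N := by
      linear_combination (curvature r * C₁) ^ 2 * N ^ 2 * hqq
    linarith

lemma isCompact_sq_dist_le {m : Type*} [Fintype m] (c : m → ℝ) (R : ℝ) :
    IsCompact {b : m → ℝ | (b - c) ⬝ᵥ (b - c) ≤ R} := by
  refine Metric.isCompact_of_isClosed_isBounded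
    (isClosed_le (by fun_prop) continuous_const) ?_
  refine (Metric.isBounded_closedBall (x := c) (r := Real.sqrt R)).subset fun b hb => ?_
  rw [Metric.mem_closedBall, dist_pi_le_iff (Real.sqrt_nonneg _)]
  intro j
  rw [Real.dist_eq]
  refine Real.abs_le_sqrt (le_trans ?_ hb)
  rw [sq]
  exact Finset.single_le_sum (f := fun j => (b - c) j * (b - c) j)
    (fun j _ => mul_self_nonneg _) (Finset.mem_univ j)

lemma continuous_logLik : Continuous (logLik X S y) := by
  have : Continuous psi := continuous_iff_continuousAt.2 fun t => (hasDerivAt_psi t).continuousAt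
  unfold logLik
  fun_prop

/-- A maximizer exists as soon as the parameter space contains the ball in which
`sq_dist_le_of_logLik_le` confines it. -/
lemma exists_isMLE (hn : 0 < n) (hC₁ : 0 < C₁) (h : DesignCondition X S M C₁ C₂)
    (hb₀ : ∀ i, |subRow X S i ⬝ᵥ b₀| < r)
    (hball : ∀ b : S → ℝ, (curvature r * C₁) ^ 2 * n * ((b - b₀) ⬝ᵥ (b - b₀))
      ≤ 4 * (score X S y b₀ ⬝ᵥ score X S y b₀) → b ∈ paramSpace X S r) :
    ∃ b, IsMLE X S r y b := by
  have hn' : (0 : ℝ) < n := by exact_mod_cast hn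
  have hc : 0 < (curvature r * C₁) ^ 2 * n := by
    have := curvature_pos r
    positivity
  set R := 4 * (score X S y b₀ ⬝ᵥ score X S y b₀)
  set B := {b : S → ℝ | (b - b₀) ⬝ᵥ (b - b₀) ≤ R / ((curvature r * C₁) ^ 2 * n)} with hB
  have hB' : ∀ b, b ∈ B ↔ (curvature r * C₁) ^ 2 * n * ((b - b₀) ⬝ᵥ (b - b₀)) ≤ R := fun b => by
    rw [hB, Set.mem_ofPred_eq, le_div_iff₀' hc]
  have hmem : b₀ ∈ B := by
    have := dotProduct_self_nonneg (score X S y b₀)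
    rw [hB', sub_self, zero_dotProduct, mul_zero]
    positivity
  obtain ⟨b₁, hb₁, hmax⟩ := (isCompact_sq_dist_le b₀ _).exists_isMaxOn ⟨b₀, hmem⟩
    (continuous_logLik (X := X) (S := S) (y := y)).continuousOn
  refine ⟨b₁, hball b₁ ((hB' _).1 hb₁), fun b hb => ?_⟩
  by_cases hbB : b ∈ B
  · exact hmax hbB
  · have : logLik X S y b < logLik X S y b₀ := by
      by_contra hcon
      exact hbB ((hB' b).2 (sq_dist_le_of_logLik_le hn hC₁ h (fun i => (hb₀ i).le)
        (fun i => (hb i).le) (not_lt.1 hcon)))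
    exact this.le.trans (hmax hmem)

lemma isOpen_paramSpace : IsOpen (paramSpace X S r) := by
  simp only [paramSpace, Set.ofPred_forall]
  exact isOpen_iInter_of_finite fun i => isOpen_lt (by fun_prop) continuous_const

/-- The likelihood equations. -/
lemma IsMLE.score_equation (hb : IsMLE X S r y b) (u : S → ℝ) :
    ∑ i, (y i - Real.sigmoid (subRow X S i ⬝ᵥ b)) * (subRow X S i ⬝ᵥ u) = 0 := by
  have hmax : IsLocalMax (fun t : ℝ => logLik X S y (b + t • u)) 0 := by
    have hcont : ContinuousAt (fun t : ℝ => b + t • u) 0 := by fun_prop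
    have hloc : IsLocalMax (logLik X S y) (b + (0 : ℝ) • u) := by
      rw [zero_smul, add_zero]
      exact hb.2.isLocalMax (isOpen_paramSpace.mem_nhds hb.1)
    exact hcont.eventually hloc
  refine hmax.hasDerivAt_eq_zero ?_
  simp only [logLik, dotProduct_add, dotProduct_smul, smul_eq_mul]
  refine HasDerivAt.fun_sum fun i _ => ?_
  have hlin : HasDerivAt (fun t : ℝ => subRow X S i ⬝ᵥ b + t * (subRow X S i ⬝ᵥ u))
      (subRow X S i ⬝ᵥ u) 0 := by
    simpa using ((hasDerivAt_id (0 : ℝ)).mul_const (subRow X S i ⬝ᵥ u)).const_add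
      (subRow X S i ⬝ᵥ b)
  have hpsi : HasDerivAt (fun t : ℝ => psi (subRow X S i ⬝ᵥ b + t * (subRow X S i ⬝ᵥ u)))
      (Real.sigmoid (subRow X S i ⬝ᵥ b) * (subRow X S i ⬝ᵥ u)) 0 := by
    refine HasDerivAt.comp (h₂ := psi) (0 : ℝ) ?_ hlin
    simpa using hasDerivAt_psi (subRow X S i ⬝ᵥ b)
  convert! (hlin.const_mul (y i)).sub hpsi using 1
  ring

/-- The Taylor remainder of the likelihood equations, in the direction `u`. -/
lemma IsMLE.abs_info_sub_score_le (hn : 0 < n) (h : DesignCondition X S M C₁ C₂)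
    (hb : IsMLE X S r y b) (u : S → ℝ) :
    |Real.sqrt n * ((info X S b₀).mulVec u ⬝ᵥ (b - b₀)) - u ⬝ᵥ score X S y b₀|
      ≤ Real.sqrt n * Real.sqrt (M ^ 2 * S.card * C₂) * ((b - b₀) ⬝ᵥ (b - b₀))
        * Real.sqrt (u ⬝ᵥ (gram X S).mulVec u) := by
  have hn' : (0 : ℝ) < n := by exact_mod_cast hn
  set δ := b - b₀ with hδ
  set N := δ ⬝ᵥ δ with hN
  have hN0 : 0 ≤ N := dotProduct_self_nonneg δ
  set q := Real.sqrt n with hq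
  have hq0 : 0 < q := Real.sqrt_pos.2 hn'
  have hqq : q * q = n := Real.mul_self_sqrt hn'.le
  set x : Fin n → S → ℝ := subRow X S
  -- both terms are `n^{-1/2}` times a sum over the observations
  have e1 : q * ((info X S b₀).mulVec u ⬝ᵥ δ) = q⁻¹ * ∑ i,
      Real.sigmoid (x i ⬝ᵥ b₀) * (1 - Real.sigmoid (x i ⬝ᵥ b₀)) * (x i ⬝ᵥ δ) * (x i ⬝ᵥ u) := by
    rw [dotProduct_comm, dotProduct_info_mulVec, deriv_deriv_psi, ← mul_assoc, ← hqq]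
    congr 1
    field_simp
  have e2 : u ⬝ᵥ score X S y b₀ = q⁻¹ * ∑ i,
      (Real.sigmoid (x i ⬝ᵥ b) - Real.sigmoid (x i ⬝ᵥ b₀)) * (x i ⬝ᵥ u) := by
    rw [dotProduct_comm, score_dotProduct]
    congr 1
    have := hb.score_equation u
    rw [← sub_eq_zero, ← Finset.sum_sub_distrib, ← this]
    exact Finset.sum_congr rfl fun i _ => by ring
  have hxδ : ∀ i, |x i ⬝ᵥ δ| ≤ Real.sqrt (M ^ 2 * S.card * N) := fun i =>
    Real.abs_le_sqrt (h.sq_row_dotProduct_le i δ)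
  have hG : ∀ v : S → ℝ, ∑ i, (x i ⬝ᵥ v) ^ 2 = n * (v ⬝ᵥ (gram X S).mulVec v) := fun v => by
    rw [dotProduct_gram_mulVec, mul_inv_cancel_left₀ (by positivity)]
    simp only [sq, x]
  have hCS : ∑ i, |x i ⬝ᵥ δ| * |x i ⬝ᵥ u| ≤
      Real.sqrt (n * (C₂ * N)) * Real.sqrt (n * (u ⬝ᵥ (gram X S).mulVec u)) := by
    refine (Real.sum_mul_le_sqrt_mul_sqrt _ _ _).trans ?_
    simp only [sq_abs, hG]
    refine mul_le_mul_of_nonneg_right (Real.sqrt_le_sqrt ?_) (Real.sqrt_nonneg _)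
    exact mul_le_mul_of_nonneg_left (h.gram_le δ) hn'.le
  rw [e1, e2, ← mul_sub, ← Finset.sum_sub_distrib, abs_mul, abs_of_pos (inv_pos.2 hq0)]
  have hsum : |∑ i, (Real.sigmoid (x i ⬝ᵥ b₀) * (1 - Real.sigmoid (x i ⬝ᵥ b₀)) * (x i ⬝ᵥ δ)
      * (x i ⬝ᵥ u) - (Real.sigmoid (x i ⬝ᵥ b) - Real.sigmoid (x i ⬝ᵥ b₀)) * (x i ⬝ᵥ u))|
      ≤ Real.sqrt (M ^ 2 * S.card * N) * ∑ i, |x i ⬝ᵥ δ| * |x i ⬝ᵥ u| := by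
    rw [Finset.mul_sum]
    refine (Finset.abs_sum_le_sum_abs _ _).trans (Finset.sum_le_sum fun i _ => ?_)
    have ht := abs_sigmoid_taylor_le (x i ⬝ᵥ b₀) (x i ⬝ᵥ b)
    rw [← dotProduct_sub, ← hδ] at ht
    rw [← sub_mul, abs_mul, ← mul_assoc, abs_sub_comm]
    refine mul_le_mul_of_nonneg_right (ht.trans ?_) (abs_nonneg _)
    rw [← sq_abs, sq]
    exact mul_le_mul_of_nonneg_right (hxδ i) (abs_nonneg _)
  refine (mul_le_mul_of_nonneg_left (hsum.trans (mul_le_mul_of_nonneg_left hCS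
    (Real.sqrt_nonneg _))) (inv_nonneg.2 hq0.le)).trans (le_of_eq ?_)
  have hMK : 0 ≤ M ^ 2 * (S.card : ℝ) := by positivity
  rw [Real.sqrt_mul hMK N, Real.sqrt_mul hMK C₂, Real.sqrt_mul hn'.le, Real.sqrt_mul hn'.le,
    Real.sqrt_mul' C₂ hN0, ← hq]
  have hNN : Real.sqrt N * Real.sqrt N = N := Real.mul_self_sqrt hN0
  have hqi : q⁻¹ * q = 1 := inv_mul_cancel₀ hq0.ne'
  linear_combination q * Real.sqrt (M ^ 2 * S.card) * Real.sqrt C₂ *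
    Real.sqrt (u ⬝ᵥ (gram X S).mulVec u) * (Real.sqrt N * Real.sqrt N * hqi + hNN)

/-- On the event `‖s‖² ≤ L |S|`, the remainder of the linear expansion is bounded uniformly in
the direction `η`. -/
lemma IsMLE.abs_stdError_sub_linTerm_le (hn : 0 < n) (hC₁ : 0 < C₁)
    (h : DesignCondition X S M C₁ C₂) (hb₀ : ∀ i, |subRow X S i ⬝ᵥ b₀| < r)
    (hb : IsMLE X S r y b) {L : ℝ} (hL : score X S y b₀ ⬝ᵥ score X S y b₀ ≤ L * S.card)
    {η : S → ℝ} (hη : η ≠ 0) :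
    |stdError X S b₀ η b - linTerm X S b₀ η y|
      ≤ 4 * L * Real.sqrt (M ^ 2 * C₂ / curvature r) / (curvature r * C₁) ^ 2
        * Real.sqrt ((S.card : ℝ) ^ 3 / n) := by
  have hn' : (0 : ℝ) < n := by exact_mod_cast hn
  have hc := curvature_pos r
  obtain ⟨u, hu, rfl, hσ, hlin⟩ := exists_info_mulVec_eq hC₁ h (fun i => (hb₀ i).le) hη
  have h1 := hb.abs_info_sub_score_le (b₀ := b₀) hn h u
  have h2 := sq_dist_le_of_logLik_le hn hC₁ h (fun i => (hb₀ i).le) (fun i => (hb.1 i).le)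
    (hb.2 hb₀)
  have h3 := curvature_mul_gram_le_info (fun i => (hb₀ i).le) u
  have h4 := h.le_gram u
  have hu0 : 0 < u ⬝ᵥ u :=
    lt_of_le_of_ne (dotProduct_self_nonneg u) fun h => hu (dotProduct_self_eq_zero.1 h.symm)
  rw [stdError, linTerm, hσ, hlin]
  set q := Real.sqrt n with hq
  have hq0 : 0 < q := Real.sqrt_pos.2 hn'
  have hqq : q * q = n := Real.mul_self_sqrt hn'.le
  set N := (b - b₀) ⬝ᵥ (b - b₀)
  set G := u ⬝ᵥ (gram X S).mulVec u
  set I := u ⬝ᵥ (info X S b₀).mulVec u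
  have hG : 0 < G := (mul_pos hC₁ hu0).trans_le h4
  have hI : 0 < I := (mul_pos hc hG).trans_le h3
  have hN : N ≤ 4 * L * S.card / ((curvature r * C₁) ^ 2 * n) := by
    rw [le_div_iff₀' (by positivity)]
    linarith
  have hGI : (Real.sqrt I)⁻¹ * Real.sqrt G ≤ Real.sqrt (1 / curvature r) := by
    rw [inv_mul_le_iff₀ (Real.sqrt_pos.2 hI), ← Real.sqrt_mul hI.le]
    refine Real.sqrt_le_sqrt ?_
    rw [mul_one_div, le_div_iff₀ hc]
    linarith
  rw [mul_comm q, mul_assoc, ← mul_sub, abs_mul, abs_of_pos (inv_pos.2 (Real.sqrt_pos.2 hI))]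
  have hstep : (Real.sqrt I)⁻¹ * (q * Real.sqrt (M ^ 2 * S.card * C₂) * N * Real.sqrt G)
      = q * Real.sqrt (M ^ 2 * S.card * C₂) * N * ((Real.sqrt I)⁻¹ * Real.sqrt G) := by ring
  have hN0 : 0 ≤ N := dotProduct_self_nonneg _
  refine (mul_le_mul_of_nonneg_left h1 (inv_nonneg.2 (Real.sqrt_nonneg _))).trans ?_
  rw [hstep]
  refine (mul_le_mul_of_nonneg_left hGI (by positivity)).trans ?_
  have hk : Real.sqrt ((S.card : ℝ) ^ 3 / n) = S.card * Real.sqrt S.card / q := by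
    rw [Real.sqrt_div (by positivity), pow_succ, Real.sqrt_mul (by positivity),
      Real.sqrt_sq (by positivity)]
  have hm : Real.sqrt (M ^ 2 * S.card * C₂) * Real.sqrt (1 / curvature r)
      = Real.sqrt (M ^ 2 * C₂ / curvature r) * Real.sqrt S.card := by
    rw [← Real.sqrt_mul' _ (by positivity), ← Real.sqrt_mul' _ (by positivity)]
    congr 1
    ring
  calc q * Real.sqrt (M ^ 2 * S.card * C₂) * N * Real.sqrt (1 / curvature r)
      = q * (Real.sqrt (M ^ 2 * C₂ / curvature r) * Real.sqrt S.card) * N := by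
        rw [← hm]; ring
    _ ≤ q * (Real.sqrt (M ^ 2 * C₂ / curvature r) * Real.sqrt S.card)
          * (4 * L * S.card / ((curvature r * C₁) ^ 2 * n)) :=
        mul_le_mul_of_nonneg_left hN (by positivity)
    _ = _ := by
        rw [hk, ← hqq]
        field_simp

/-- For `|S|² / n` small, a maximizer exists on the event `‖s‖² ≤ L |S|`. -/
lemma exists_isMLE_of_score_le {ξ : ℝ} (hn : 0 < n) (hC₁ : 0 < C₁) (hξ : ξ < r)
    (h : DesignCondition X S M C₁ C₂) (hb₀ : ∀ i, |subRow X S i ⬝ᵥ b₀| < ξ)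
    {L : ℝ} (hL : score X S y b₀ ⬝ᵥ score X S y b₀ ≤ L * S.card)
    (hsmall : 4 * L * M ^ 2 / (curvature r * C₁) ^ 2 * ((S.card : ℝ) ^ 2 / n) ≤ (r - ξ) ^ 2) :
    ∃ b, IsMLE X S r y b := by
  have hn' : (0 : ℝ) < n := by exact_mod_cast hn
  have hc := curvature_pos r
  refine exists_isMLE hn hC₁ h (fun i => (hb₀ i).trans hξ) fun b hb i => ?_
  have hN : (b - b₀) ⬝ᵥ (b - b₀) ≤ 4 * L * S.card / ((curvature r * C₁) ^ 2 * n) := by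
    rw [le_div_iff₀' (by positivity)]
    linarith
  have h1 : |subRow X S i ⬝ᵥ (b - b₀)| ≤ r - ξ := by
    refine abs_le_of_sq_le_sq ?_ (by linarith)
    refine (h.sq_row_dotProduct_le i _).trans (le_trans ?_ hsmall)
    refine (mul_le_mul_of_nonneg_left hN (by positivity)).trans (le_of_eq ?_)
    field_simp
  have h2 : subRow X S i ⬝ᵥ b = subRow X S i ⬝ᵥ b₀ + subRow X S i ⬝ᵥ (b - b₀) := by
    rw [← dotProduct_add, add_sub_cancel]
  rw [h2]
  have := abs_add_le (subRow X S i ⬝ᵥ b₀) (subRow X S i ⬝ᵥ (b - b₀))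
  have := hb₀ i
  linarith

end Maximizer

/-! ### A quantitative central limit theorem for bounded summands -/

lemma norm_prod_sub_prod_le {ι : Type*} (s : Finset ι) (a b : ι → ℂ)
    (ha : ∀ i ∈ s, ‖a i‖ ≤ 1) (hb : ∀ i ∈ s, ‖b i‖ ≤ 1) :
    ‖∏ i ∈ s, a i - ∏ i ∈ s, b i‖ ≤ ∑ i ∈ s, ‖a i - b i‖ := by
  classical
  induction s using Finset.induction_on with
  | empty => simp
  | insert j s hj ih =>
    rw [Finset.prod_insert hj, Finset.prod_insert hj, Finset.sum_insert hj]
    have h1 := ih (fun i hi => ha i (Finset.mem_insert_of_mem hi))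
      (fun i hi => hb i (Finset.mem_insert_of_mem hi))
    have h2 : ‖∏ i ∈ s, b i‖ ≤ 1 := by
      rw [norm_prod]
      exact Finset.prod_le_one (fun _ _ => norm_nonneg _)
        fun i hi => hb i (Finset.mem_insert_of_mem hi)
    have e : a j * ∏ i ∈ s, a i - b j * ∏ i ∈ s, b i
        = a j * (∏ i ∈ s, a i - ∏ i ∈ s, b i) + (a j - b j) * ∏ i ∈ s, b i := by ring
    rw [e]
    refine (norm_add_le _ _).trans ?_
    rw [norm_mul, norm_mul, add_comm]
    exact add_le_add (mul_le_of_le_one_right (norm_nonneg _) h2)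
      ((mul_le_of_le_one_left (norm_nonneg _) (ha j (Finset.mem_insert_self _ _))).trans h1)

lemma norm_cexp_taylor_le {x : ℝ} (hx : |x| ≤ 1) :
    ‖Complex.exp (x * Complex.I) - (1 + x * Complex.I - (x : ℂ) ^ 2 / 2)‖ ≤ 3 * |x| ^ 3 := by
  have h := Complex.norm_exp_sub_sum_le_norm_mul_exp (x * Complex.I) 3
  have hn : ‖(x : ℂ) * Complex.I‖ = |x| := by simp
  rw [hn] at h
  have he : Real.exp |x| ≤ 3 :=
    (Real.exp_le_exp.2 hx).trans (by have := Real.exp_one_lt_d9; linarith)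
  have h3 : |x| ^ 3 * Real.exp |x| ≤ 3 * |x| ^ 3 := by
    rw [mul_comm]
    exact mul_le_mul_of_nonneg_right he (by positivity)
  refine le_trans (le_of_eq ?_) (h.trans h3)
  congr 2
  simp only [Finset.sum_range_succ, Finset.sum_range_zero, mul_pow, Complex.I_sq]
  norm_num [Nat.factorial]
  ring

section CLT

variable {Ω : Type*} [MeasurableSpace Ω] {μ : Measure Ω}

lemma memLp_of_abs_le [IsProbabilityMeasure μ] {W : Ω → ℝ} {w : ℝ}
    (hm : Measurable W) (hw : ∀ ω, |W ω| ≤ w) (p : ENNReal) : MemLp W p μ :=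
  MemLp.of_bound hm.aestronglyMeasurable w (Eventually.of_forall hw)

lemma charFun_map_eq_integral {W : Ω → ℝ} (hm : Measurable W) (t : ℝ) :
    charFun (μ.map W) t = ∫ ω, Complex.exp ((t * W ω : ℝ) * Complex.I) ∂μ := by
  rw [charFun_apply_real, integral_map hm.aemeasurable (by fun_prop)]
  simp

lemma integrable_cexp_mul_I [IsProbabilityMeasure μ] {W : Ω → ℝ} (hm : Measurable W) :
    Integrable (fun ω => Complex.exp ((W ω : ℂ) * Complex.I)) μ := by
  refine Integrable.of_bound (C := 1) (by fun_prop) (Eventually.of_forall fun ω => ?_)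
  rw [Complex.norm_exp_ofReal_mul_I]

/-- Both characteristic functions agree with `1 - t² E[W²] / 2` up to the stated error. -/
lemma norm_charFun_sub_gaussian_le [IsProbabilityMeasure μ] {W : Ω → ℝ} {w t : ℝ}
    (hm : Measurable W)
    (h0 : ∫ ω, W ω ∂μ = 0) (hw : ∀ ω, |W ω| ≤ w) (ht : |t| * w ≤ 1) :
    ‖charFun (μ.map W) t - Complex.exp (-(t ^ 2 * ∫ ω, W ω ^ 2 ∂μ) / 2 : ℝ)‖
      ≤ 4 * (|t| * w) * (t ^ 2 * ∫ ω, W ω ^ 2 ∂μ) := by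
  have hw0 : 0 ≤ w := by
    obtain ⟨ω⟩ : Nonempty Ω := nonempty_of_isProbabilityMeasure μ
    exact (abs_nonneg _).trans (hw ω)
  have hint : Integrable W μ := memLp_one_iff_integrable.1 (memLp_of_abs_le hm hw 1)
  have hint2 : Integrable (fun ω => W ω ^ 2) μ := (memLp_of_abs_le hm hw 2).integrable_sq
  set v := ∫ ω, W ω ^ 2 ∂μ with hv
  have hv0 : 0 ≤ v := integral_nonneg fun ω => sq_nonneg _
  have hvw : v ≤ w ^ 2 := by
    have := integral_mono hint2 (integrable_const (w ^ 2)) fun ω =>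
      sq_le_sq' (abs_le.1 (hw ω)).1 (abs_le.1 (hw ω)).2
    simpa using this
  have htw : 0 ≤ |t| * w := by positivity
  have htv : t ^ 2 * v ≤ (|t| * w) ^ 2 := by
    rw [mul_pow, sq_abs]
    exact mul_le_mul_of_nonneg_left hvw (sq_nonneg t)
  have h1 : ‖charFun (μ.map W) t - ((1 - t ^ 2 * v / 2 : ℝ) : ℂ)‖
      ≤ 3 * (|t| * w) * (t ^ 2 * v) := by
    have i1 : Integrable (fun ω => ((t * W ω : ℝ) : ℂ) * Complex.I) μ :=
      ((hint.const_mul t).ofReal).mul_const _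
    have i2 : Integrable (fun ω => ((t * W ω : ℝ) : ℂ) ^ 2 / 2) μ := by
      have := ((hint2.const_mul (t ^ 2 / 2)).ofReal (𝕜 := ℂ))
      refine this.congr (Eventually.of_forall fun ω => ?_)
      simp
      ring
    have j1 : ∫ ω, ((t * W ω : ℝ) : ℂ) * Complex.I ∂μ = 0 := by
      rw [integral_mul_const, integral_complex_ofReal, integral_const_mul, h0]
      simp
    have j2 : ∫ ω, ((t * W ω : ℝ) : ℂ) ^ 2 / 2 ∂μ = ((t ^ 2 * v / 2 : ℝ) : ℂ) := by
      rw [hv, ← integral_const_mul, ← integral_div]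
      rw [← integral_complex_ofReal]
      refine integral_congr_ae (Eventually.of_forall fun ω => ?_)
      simp
      ring
    have i3 : Integrable (fun ω => 1 + ((t * W ω : ℝ) : ℂ) * Complex.I) μ :=
      (integrable_const _).add i1
    have i4 : Integrable (fun ω => 1 + ((t * W ω : ℝ) : ℂ) * Complex.I
        - ((t * W ω : ℝ) : ℂ) ^ 2 / 2) μ := i3.sub i2
    have e : ((1 - t ^ 2 * v / 2 : ℝ) : ℂ) = ∫ ω, (1 + (t * W ω : ℝ) * Complex.I
        - ((t * W ω : ℝ) : ℂ) ^ 2 / 2) ∂μ := by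
      rw [integral_sub i3 i2, integral_add (integrable_const _) i1, j1, j2]
      simp
    rw [e, charFun_map_eq_integral hm,
      ← integral_sub (integrable_cexp_mul_I (hm.const_mul t)) i4]
    refine (norm_integral_le_of_norm_le (hint2.const_mul (3 * (|t| * w) * t ^ 2))
      (Eventually.of_forall fun ω => ?_)).trans (le_of_eq ?_)
    · have hx : |t * W ω| ≤ |t| * w := by
        rw [abs_mul]
        exact mul_le_mul_of_nonneg_left (hw ω) (abs_nonneg t)
      refine (norm_cexp_taylor_le (hx.trans ht)).trans ?_
      have : |t * W ω| ^ 3 = |t * W ω| * (t ^ 2 * W ω ^ 2) := by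
        rw [pow_succ', sq_abs, mul_pow]
      rw [this]
      have := mul_le_mul_of_nonneg_right hx (by positivity : 0 ≤ t ^ 2 * W ω ^ 2)
      linarith
    · rw [integral_const_mul]
      ring
  have h2 : ‖((1 - t ^ 2 * v / 2 : ℝ) : ℂ) - Complex.exp (-(t ^ 2 * v) / 2 : ℝ)‖
      ≤ (|t| * w) * (t ^ 2 * v) := by
    have htv0 : 0 ≤ t ^ 2 * v := by positivity
    have htv1 : t ^ 2 * v ≤ |t| * w := htv.trans (by nlinarith)
    have := Real.abs_exp_sub_one_sub_id_le (x := -(t ^ 2 * v) / 2) (by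
      rw [abs_le]
      constructor <;> linarith)
    rw [← Complex.ofReal_exp, ← Complex.ofReal_sub, Complex.norm_real, Real.norm_eq_abs,
      abs_sub_comm]
    have e : Real.exp (-(t ^ 2 * v) / 2) - (1 - t ^ 2 * v / 2)
        = Real.exp (-(t ^ 2 * v) / 2) - 1 - -(t ^ 2 * v) / 2 := by ring
    rw [e]
    refine this.trans ?_
    nlinarith
  have := norm_sub_le_norm_sub_add_norm_sub (charFun (μ.map W) t)
    ((1 - t ^ 2 * v / 2 : ℝ) : ℂ) (Complex.exp (-(t ^ 2 * v) / 2 : ℝ))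
  linarith

/-- The characteristic function of a sum of independent centered variables bounded by `w` is
close to that of the Gaussian law with the same variance, factor by factor. -/
lemma norm_charFun_sum_sub_gaussian_le [IsProbabilityMeasure μ] {ι : Type*} [Fintype ι]
    {W : ι → Ω → ℝ} {w t : ℝ} (hm : ∀ i, Measurable (W i)) (hind : iIndepFun W μ)
    (h0 : ∀ i, ∫ ω, W i ω ∂μ = 0)
    (hw : ∀ i ω, |W i ω| ≤ w) (ht : |t| * w ≤ 1) :
    ‖charFun (μ.map fun ω => ∑ i, W i ω) t
        - Complex.exp (-(t ^ 2 * ∑ i, ∫ ω, W i ω ^ 2 ∂μ) / 2 : ℝ)‖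
      ≤ 4 * (|t| * w) * (t ^ 2 * ∑ i, ∫ ω, W i ω ^ 2 ∂μ) := by
  have e : Complex.exp (-(t ^ 2 * ∑ i, ∫ ω, W i ω ^ 2 ∂μ) / 2 : ℝ)
      = ∏ i, Complex.exp (-(t ^ 2 * ∫ ω, W i ω ^ 2 ∂μ) / 2 : ℝ) := by
    rw [← Complex.exp_sum, ← Complex.ofReal_sum]
    simp [Finset.mul_sum, Finset.sum_div, neg_div]
  have : ∀ i, IsProbabilityMeasure (μ.map (W i)) := fun i =>
    Measure.isProbabilityMeasure_map (hm i).aemeasurable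
  rw [e, hind.charFun_map_fun_sum_eq_prod fun i => (hm i).aemeasurable, Finset.prod_apply]
  refine (norm_prod_sub_prod_le _ _ _ (fun i _ => norm_charFun_le_one t) fun i _ => ?_).trans ?_
  · rw [← Complex.ofReal_exp, Complex.norm_real, Real.norm_eq_abs, Real.abs_exp,
      Real.exp_le_one_iff]
    have : 0 ≤ t ^ 2 * ∫ ω, W i ω ^ 2 ∂μ :=
      mul_nonneg (sq_nonneg _) (integral_nonneg fun ω => sq_nonneg _)
    linarith
  · rw [Finset.mul_sum, Finset.mul_sum]
    exact Finset.sum_le_sum fun i _ => norm_charFun_sub_gaussian_le (hm i) (h0 i) (hw i) ht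

/-- Characteristic functions of variables that are close in probability are close. -/
lemma norm_charFun_map_sub_le [IsProbabilityMeasure μ] {A B : Ω → ℝ}
    (hA : Measurable A) (hB : Measurable B) (t : ℝ) {ε : ℝ} (hε : 0 ≤ ε) :
    ‖charFun (μ.map A) t - charFun (μ.map B) t‖
      ≤ |t| * ε + 2 * μ.real {ω | ε < |A ω - B ω|} := by
  have hmeas : MeasurableSet {ω | ε < |A ω - B ω|} :=
    measurableSet_lt measurable_const (by fun_prop)
  rw [charFun_map_eq_integral hA, charFun_map_eq_integral hB,
    ← integral_sub (integrable_cexp_mul_I (hA.const_mul t))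
      (integrable_cexp_mul_I (hB.const_mul t))]
  have hind : Integrable ({ω | ε < |A ω - B ω|}.indicator fun _ => (2 : ℝ)) μ :=
    (integrable_const _).indicator hmeas
  refine (norm_integral_le_of_norm_le ((integrable_const (|t| * ε)).add hind)
    (Eventually.of_forall fun ω => ?_)).trans (le_of_eq ?_)
  · by_cases h : ε < |A ω - B ω|
    · have h2 : ‖Complex.exp ((t * A ω : ℝ) * Complex.I)
          - Complex.exp ((t * B ω : ℝ) * Complex.I)‖ ≤ 2 := by
        refine (norm_sub_le _ _).trans ?_
        rw [Complex.norm_exp_ofReal_mul_I, Complex.norm_exp_ofReal_mul_I]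
        norm_num
      have : 0 ≤ |t| * ε := by positivity
      simp only [Pi.add_apply, Set.indicator, Set.mem_ofPred_eq, h, if_true]
      linarith
    · have e : Complex.exp ((t * A ω : ℝ) * Complex.I) - Complex.exp ((t * B ω : ℝ) * Complex.I)
          = Complex.exp ((t * B ω : ℝ) * Complex.I)
            * (Complex.exp (Complex.I * (t * (A ω - B ω) : ℝ)) - 1) := by
        rw [mul_sub, ← Complex.exp_add, mul_one]
        congr 2
        push_cast
        ring
      simp only [Pi.add_apply, Set.indicator, Set.mem_ofPred_eq, h, if_false, add_zero]
      rw [e, norm_mul, Complex.norm_exp_ofReal_mul_I, one_mul]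
      refine Real.norm_exp_I_mul_ofReal_sub_one_le.trans ?_
      rw [Real.norm_eq_abs, abs_mul]
      exact mul_le_mul_of_nonneg_left (not_lt.1 h) (abs_nonneg t)
  · simp only [Pi.add_apply]
    rw [integral_add (integrable_const _) hind, integral_indicator hmeas]
    simp [mul_comm]

/-- **Slutsky's lemma** on varying probability spaces: a sequence that is close in probability to
one whose characteristic functions converge to those of `ν` converges in distribution to `ν`. -/
lemma tendstoInDistribution_of_charFun_of_sub {Ω : ℕ → Type*} [∀ n, MeasurableSpace (Ω n)]
    {μ : ∀ n, Measure (Ω n)} [∀ n, IsProbabilityMeasure (μ n)] {ν : Measure ℝ}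
    [IsProbabilityMeasure ν] {A B : ∀ n, Ω n → ℝ} (hA : ∀ n, Measurable (A n))
    (hB : ∀ n, Measurable (B n))
    (hAB : ∀ ε : ℝ, 0 < ε → Tendsto (fun n => μ n {ω | ε < |A n ω - B n ω|}) atTop (𝓝 0))
    (hlim : ∀ t, Tendsto (fun n => charFun ((μ n).map (B n)) t) atTop (𝓝 (charFun ν t))) :
    TendstoInDistribution A atTop (id : ℝ → ℝ) μ ν := by
  refine ⟨fun n => (hA n).aemeasurable, by fun_prop, ?_⟩
  refine ProbabilityMeasure.tendsto_iff_tendsto_charFun.2 fun t => ?_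
  simp only [ProbabilityMeasure.coe_mk, Measure.map_id]
  have hdiff : Tendsto (fun n => charFun ((μ n).map (A n)) t - charFun ((μ n).map (B n)) t)
      atTop (𝓝 0) := by
    rw [tendsto_zero_iff_norm_tendsto_zero, Metric.tendsto_nhds]
    intro τ hτ
    set ε : ℝ := τ / (2 * (|t| + 1)) with hε
    have hε0 : 0 < ε := by positivity
    have htε : |t| * ε ≤ τ / 2 := by
      have h1 : (|t| + 1) * ε = τ / 2 := by
        rw [hε]
        field_simp
      nlinarith
    have hr := ((ENNReal.tendsto_toReal ENNReal.zero_ne_top).comp (hAB ε hε0)).eventually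
      (gt_mem_nhds (by simpa using hτ : (0 : ENNReal).toReal < τ / 4))
    filter_upwards [hr] with n hn
    have hle := norm_charFun_map_sub_le (μ := μ n) (hA n) (hB n) t hε0.le
    rw [Real.dist_eq, sub_zero, abs_norm]
    simp only [Function.comp_apply] at hn
    rw [measureReal_def] at hle
    linarith
  simpa using hdiff.add (hlim t)

lemma integral_sq_sum_eq [IsProbabilityMeasure μ] {ι : Type*} [Fintype ι] {W : ι → Ω → ℝ} {w : ℝ}
    (hm : ∀ i, Measurable (W i)) (hind : iIndepFun W μ) (h0 : ∀ i, ∫ ω, W i ω ∂μ = 0)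
    (hw : ∀ i ω, |W i ω| ≤ w) :
    ∫ ω, (∑ i, W i ω) ^ 2 ∂μ = ∑ i, ∫ ω, W i ω ^ 2 ∂μ := by
  have hL : ∀ i ∈ Finset.univ, MemLp (W i) 2 μ := fun i _ => memLp_of_abs_le (hm i) (hw i) 2
  have h := IndepFun.variance_sum hL fun i _ j _ hij => hind.indepFun hij
  rw [variance_of_integral_eq_zero (by fun_prop)] at h
  · simpa [variance_of_integral_eq_zero (hm _).aemeasurable (h0 _)] using h
  · simp only [Finset.sum_apply]
    rw [integral_finsetSum _ fun i hi => (hL i hi).integrable (by norm_num)]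
    simp [h0]

end CLT

/-! ### The logistic model -/

section Model

variable {Ω : Type*} [MeasurableSpace Ω] {μ : Measure Ω}
  {n d : ℕ} {X : Matrix (Fin n) (Fin d) ℝ} {β : Fin d → ℝ} {y : Fin n → Ω → ℝ}

namespace IsLogisticModel

lemma abs_residual_le (h : IsLogisticModel μ X β y) (i : Fin n) (ω : Ω) :
    |y i ω - Real.sigmoid (X i ⬝ᵥ β)| ≤ 1 := by
  have h0 := Real.sigmoid_nonneg (X i ⬝ᵥ β)
  have h1 := Real.sigmoid_le_one (X i ⬝ᵥ β)
  rw [abs_le]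
  rcases h.binary i ω with e | e <;> rw [e] <;> constructor <;> linarith

lemma integrable [IsProbabilityMeasure μ] (h : IsLogisticModel μ X β y) (i : Fin n) :
    Integrable (y i) μ :=
  memLp_one_iff_integrable.1 <| memLp_of_abs_le (w := 1) (h.measurable i)
    (fun ω => by rcases h.binary i ω with e | e <;> simp [e]) 1

lemma integral_eq [IsProbabilityMeasure μ] (h : IsLogisticModel μ X β y) (i : Fin n) :
    ∫ ω, y i ω ∂μ = Real.sigmoid (X i ⬝ᵥ β) := by
  have e : y i = {ω | y i ω = 1}.indicator 1 := by
    ext ω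
    rcases h.binary i ω with e | e <;> simp [Set.indicator, e]
  have hs : MeasurableSet {ω | y i ω = 1} := h.measurable i (measurableSet_singleton 1)
  rw [e, integral_indicator_one hs, h.prob i, deriv_psi]

lemma integral_residual [IsProbabilityMeasure μ] (h : IsLogisticModel μ X β y) (i : Fin n) :
    ∫ ω, (y i ω - Real.sigmoid (X i ⬝ᵥ β)) ∂μ = 0 := by
  rw [integral_sub (h.integrable i) (integrable_const _), h.integral_eq]
  simp

lemma integral_sq_residual [IsProbabilityMeasure μ] (h : IsLogisticModel μ X β y) (i : Fin n) :
    ∫ ω, (y i ω - Real.sigmoid (X i ⬝ᵥ β)) ^ 2 ∂μ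
      = Real.sigmoid (X i ⬝ᵥ β) * (1 - Real.sigmoid (X i ⬝ᵥ β)) := by
  set p := Real.sigmoid (X i ⬝ᵥ β) with hp
  have e : ∀ ω, (y i ω - p) ^ 2 = (1 - 2 * p) * y i ω + p ^ 2 := fun ω => by
    rcases h.binary i ω with e | e <;> rw [e] <;> ring
  simp_rw [e]
  rw [integral_add ((h.integrable i).const_mul _) (integrable_const _), integral_const_mul,
    h.integral_eq, ← hp]
  simp
  ring

lemma measurable_residual (h : IsLogisticModel μ X β y) (i : Fin n) (c : ℝ) :
    Measurable fun ω => c * (y i ω - Real.sigmoid (X i ⬝ᵥ β)) := by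
  have := h.measurable i
  fun_prop

lemma iIndepFun_residual (h : IsLogisticModel μ X β y) (c : Fin n → ℝ) :
    iIndepFun (fun i ω => c i * (y i ω - Real.sigmoid (X i ⬝ᵥ β))) μ :=
  h.indep.comp (fun i x => c i * (x - Real.sigmoid (X i ⬝ᵥ β))) fun i => by fun_prop

end IsLogisticModel
end Model

section Model

variable {Ω : Type*} [MeasurableSpace Ω] {μ : Measure Ω}
  {n d : ℕ} {X : Matrix (Fin n) (Fin d) ℝ} {β : Fin d → ℝ} {y : Fin n → Ω → ℝ}
  {S : Finset (Fin d)} {M C₁ C₂ r : ℝ}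

lemma subRow_dotProduct_subVec (hS : ∀ j, β j ≠ 0 → j ∈ S) (i : Fin n) :
    subRow X S i ⬝ᵥ subVec β S = X i ⬝ᵥ β := by
  simp only [dotProduct, subRow, subVec]
  rw [Finset.sum_coe_sort S fun j => X i j * β j]
  refine Finset.sum_subset (Finset.subset_univ S) fun j _ hj => ?_
  rw [not_not.1 fun h0 => hj (hS j h0), mul_zero]

lemma score_apply (hS : ∀ j, β j ≠ 0 → j ∈ S) (z : Fin n → ℝ) (j : S) :
    score X S z (subVec β S) j
      = ∑ i, (Real.sqrt n)⁻¹ * subRow X S i j * (z i - Real.sigmoid (X i ⬝ᵥ β)) := by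
  simp only [score, Pi.smul_apply, Finset.sum_apply, smul_eq_mul, Finset.mul_sum, deriv_psi,
    subRow_dotProduct_subVec hS]
  exact Finset.sum_congr rfl fun i _ => by ring

lemma IsLogisticModel.integral_sq_linear [IsProbabilityMeasure μ] (h : IsLogisticModel μ X β y)
    (c : Fin n → ℝ) :
    ∫ ω, (∑ i, c i * (y i ω - Real.sigmoid (X i ⬝ᵥ β))) ^ 2 ∂μ
      = ∑ i, c i ^ 2 * (Real.sigmoid (X i ⬝ᵥ β) * (1 - Real.sigmoid (X i ⬝ᵥ β))) := by
  have hw : ∀ i ω, |c i * (y i ω - Real.sigmoid (X i ⬝ᵥ β))| ≤ ∑ i, |c i| := fun i ω => by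
    rw [abs_mul]
    exact (mul_le_of_le_one_right (abs_nonneg _) (h.abs_residual_le i ω)).trans
      (Finset.single_le_sum (f := fun i => |c i|) (fun i _ => abs_nonneg _) (Finset.mem_univ i))
  rw [integral_sq_sum_eq (fun i => h.measurable_residual i (c i)) (h.iIndepFun_residual c)
    (fun i => by rw [integral_const_mul, h.integral_residual, mul_zero]) hw]
  refine Finset.sum_congr rfl fun i _ => ?_
  simp_rw [mul_pow]
  rw [integral_const_mul, h.integral_sq_residual]

lemma measurable_score (h : IsLogisticModel μ X β y) (b : S → ℝ) :
    Measurable fun ω => score X S (fun i => y i ω) b := by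
  have := h.measurable
  unfold score
  fun_prop

/-- The score has squared norm of order `|S|` in mean, hence in probability. -/
lemma IsLogisticModel.measureReal_score_le [IsProbabilityMeasure μ] (h : IsLogisticModel μ X β y)
    (hd : DesignCondition X S M C₁ C₂) (hS : ∀ j, β j ≠ 0 → j ∈ S) (hn : 0 < n)
    (hcard : 0 < S.card) {L : ℝ} (hL : 0 < L) :
    μ.real {ω | L * S.card ≤ score X S (fun i => y i ω) (subVec β S) ⬝ᵥ
      score X S (fun i => y i ω) (subVec β S)} ≤ M ^ 2 / L := by
  have hn' : (0 : ℝ) < n := by exact_mod_cast hn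
  have hk : (0 : ℝ) < S.card := by exact_mod_cast hcard
  have hmeas := measurable_score h (subVec β S)
  set s : Ω → S → ℝ := fun ω => score X S (fun i => y i ω) (subVec β S) with hs
  have hsj : ∀ j : S, (fun ω => s ω j) = fun ω =>
      ∑ i, (Real.sqrt n)⁻¹ * subRow X S i j * (y i ω - Real.sigmoid (X i ⬝ᵥ β)) := fun j =>
    funext fun ω => score_apply hS _ j
  have hint : ∀ j : S, Integrable (fun ω => s ω j ^ 2) μ := fun j => by
    refine (memLp_of_abs_le (w := ∑ i, |(Real.sqrt n)⁻¹ * subRow X S i j|)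
      (by fun_prop) (fun ω => ?_) 2).integrable_sq
    rw [congrFun (hsj j) ω]
    refine (Finset.abs_sum_le_sum_abs _ _).trans (Finset.sum_le_sum fun i _ => ?_)
    rw [abs_mul]
    exact mul_le_of_le_one_right (abs_nonneg _) (h.abs_residual_le i ω)
  have hss : (fun ω => s ω ⬝ᵥ s ω) = fun ω => ∑ j, s ω j ^ 2 := by
    funext ω
    simp only [dotProduct, sq]
  have hbound : ∫ ω, s ω ⬝ᵥ s ω ∂μ ≤ M ^ 2 * S.card := by
    rw [hss, integral_finsetSum _ fun j _ => hint j]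
    have hj : ∀ j : S, ∫ ω, s ω j ^ 2 ∂μ ≤ (n : ℝ)⁻¹ * ∑ i, subRow X S i j ^ 2 := fun j => by
      simp_rw [congrFun (hsj j)]
      rw [h.integral_sq_linear, Finset.mul_sum]
      refine Finset.sum_le_sum fun i _ => ?_
      rw [mul_pow, inv_pow, Real.sq_sqrt hn'.le]
      refine mul_le_of_le_one_right (by positivity) ?_
      have h0 := Real.sigmoid_nonneg (X i ⬝ᵥ β)
      have h1 := Real.sigmoid_le_one (X i ⬝ᵥ β)
      nlinarith
    refine (Finset.sum_le_sum fun j _ => hj j).trans ?_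
    rw [← Finset.mul_sum, Finset.sum_comm, inv_mul_le_iff₀ hn']
    refine (Finset.sum_le_card_nsmul _ _ (M ^ 2 * S.card) fun i _ => ?_).trans (by simp)
    simpa [dotProduct, sq] using hd.row_dotProduct_self_le i
  have hI : Integrable (fun ω => s ω ⬝ᵥ s ω) μ := by
    rw [hss]
    exact integrable_finsetSum _ fun j _ => hint j
  have hM := (mul_meas_ge_le_integral_of_nonneg
    (Eventually.of_forall fun ω => dotProduct_self_nonneg (s ω)) hI (L * S.card)).trans hbound
  rw [le_div_iff₀ hL]
  refine le_of_mul_le_mul_right (le_trans (le_of_eq ?_) hM) hk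
  ring

/-- The linear term is a sum of independent centered variables with total variance `1`, each
bounded by a multiple of `√(|S| / n)`; so its law is nearly standard Gaussian. -/
lemma IsLogisticModel.norm_charFun_linTerm_sub_le [IsProbabilityMeasure μ]
    (h : IsLogisticModel μ X β y) (hn : 0 < n) (hC₁ : 0 < C₁) (hd : DesignCondition X S M C₁ C₂)
    (hS : ∀ j, β j ≠ 0 → j ∈ S) (hb : ∀ i, |subRow X S i ⬝ᵥ subVec β S| ≤ r)
    {η : S → ℝ} (hη : η ≠ 0) {t : ℝ}
    (ht : |t| * Real.sqrt (M ^ 2 / (curvature r * C₁) * (S.card / n)) ≤ 1) :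
    ‖charFun (μ.map fun ω => linTerm X S (subVec β S) η fun i => y i ω) t
        - Complex.exp (-t ^ 2 / 2 : ℝ)‖
      ≤ 4 * (|t| * Real.sqrt (M ^ 2 / (curvature r * C₁) * (S.card / n))) * t ^ 2 := by
  have hn' : (0 : ℝ) < n := by exact_mod_cast hn
  have hc := curvature_pos r
  obtain ⟨u, hu, hη', hσ, hlin⟩ := exists_info_mulVec_eq hC₁ hd hb hη
  obtain ⟨hI0, hI1⟩ := info_lower_bound hC₁ hd hb hu
  have hinfo := dotProduct_info_mulVec (X := X) (subVec β S) u u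
  set I := u ⬝ᵥ (info X S (subVec β S)).mulVec u with hI
  have hIpos : 0 < I := hI0.trans_le hI1
  set a : Fin n → ℝ := fun i => (Real.sqrt I)⁻¹ * ((Real.sqrt n)⁻¹ * (subRow X S i ⬝ᵥ u)) with ha
  have hasq : ∀ i, a i ^ 2 = I⁻¹ * ((n : ℝ)⁻¹ * (subRow X S i ⬝ᵥ u) ^ 2) := fun i => by
    rw [ha]
    simp only [mul_pow, inv_pow]
    rw [Real.sq_sqrt hIpos.le, Real.sq_sqrt hn'.le]
  have hlin' : (fun ω => linTerm X S (subVec β S) η fun i => y i ω)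
      = fun ω => ∑ i, a i * (y i ω - Real.sigmoid (X i ⬝ᵥ β)) := by
    funext ω
    rw [linTerm, hσ, hlin, dotProduct_comm, score_dotProduct, ← mul_assoc, Finset.mul_sum]
    refine Finset.sum_congr rfl fun i _ => ?_
    rw [subRow_dotProduct_subVec hS]
    simp only [ha]
    ring
  have ha_le : ∀ i, |a i| ≤ Real.sqrt (M ^ 2 / (curvature r * C₁) * (S.card / n)) := fun i => by
    refine Real.abs_le_sqrt ?_
    rw [hasq, inv_mul_le_iff₀ hIpos, inv_mul_le_iff₀ hn']
    refine (hd.sq_row_dotProduct_le i u).trans ?_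
    have e : (n : ℝ) * (I * (M ^ 2 / (curvature r * C₁) * (S.card / n)))
        = M ^ 2 * S.card * (I / (curvature r * C₁)) := by field_simp
    rw [e]
    refine mul_le_mul_of_nonneg_left ?_ (by positivity)
    rw [le_div_iff₀ (by positivity)]
    linarith
  have hvar : ∑ i, ∫ ω, (a i * (y i ω - Real.sigmoid (X i ⬝ᵥ β))) ^ 2 ∂μ = 1 := by
    simp_rw [mul_pow, integral_const_mul, h.integral_sq_residual, hasq]
    refine Eq.trans ?_ (inv_mul_cancel₀ hIpos.ne')
    refine Eq.trans ?_ (congrArg (I⁻¹ * ·) hinfo.symm)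
    simp only [deriv_deriv_psi, Finset.mul_sum]
    refine Finset.sum_congr rfl fun i _ => ?_
    rw [subRow_dotProduct_subVec hS]
    ring
  have hmain := norm_charFun_sum_sub_gaussian_le (t := t)
    (fun i => h.measurable_residual i (a i)) (h.iIndepFun_residual a)
    (fun i => by rw [integral_const_mul, h.integral_residual, mul_zero])
    (fun i ω => by
      rw [abs_mul]
      exact (mul_le_of_le_one_right (abs_nonneg _) (h.abs_residual_le i ω)).trans (ha_le i)) ht
  rw [hvar, mul_one] at hmain
  rw [hlin']
  exact hmain

lemma measurable_linTerm (h : IsLogisticModel μ X β y) (b η : S → ℝ) :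
    Measurable fun ω => linTerm X S b η fun i => y i ω := by
  have := measurable_score (S := S) h b
  unfold linTerm
  simp only [dotProduct, Matrix.mulVec]
  fun_prop

end Model

lemma measurable_stdError {n d : ℕ} (X : Matrix (Fin n) (Fin d) ℝ) (S : Finset (Fin d))
    (b η : S → ℝ) : Measurable (stdError X S b η) := by
  unfold stdError
  simp only [dotProduct]
  fun_prop

/-! ### Asymptotics along the sequence of models -/

/-- `K^3 / n → 0` controls the lower powers, because `K` is integral. -/
lemma tendsto_pow_div_of_cube {K : ℕ → ℕ}
    (hK : Tendsto (fun n : ℕ => (K n : ℝ) ^ 3 / (n : ℝ)) atTop (𝓝 0)) {p : ℕ} (hp : p ≠ 0)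
    (hp3 : p ≤ 3) : Tendsto (fun n : ℕ => (K n : ℝ) ^ p / (n : ℝ)) atTop (𝓝 0) := by
  refine squeeze_zero (fun n => by positivity) (fun n => ?_) hK
  refine div_le_div_of_nonneg_right ?_ (Nat.cast_nonneg n)
  rcases Nat.eq_zero_or_pos (K n) with h | h
  · simp [h, hp]
  · exact pow_le_pow_right₀ (by exact_mod_cast h) hp3

/-- The remainder of the linear expansion tends to zero in probability, uniformly in the direction
and the submodel: the event in question is contained in the event that the score is large. -/
theorem tendsto_iSup_measure_remainder
    {Ω : ℕ → Type*} [∀ n, MeasurableSpace (Ω n)]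
    (μ : ∀ n, Measure (Ω n)) [∀ n, IsProbabilityMeasure (μ n)]
    (d K : ℕ → ℕ)
    (X : ∀ n, Matrix (Fin n) (Fin (d n)) ℝ)
    (β : ∀ n, Fin (d n) → ℝ)
    (y : ∀ n, Fin n → Ω n → ℝ)
    (hmodel : ∀ n, IsLogisticModel (μ n) (X n) (β n) (y n))
    (𝒮 : ∀ n, Set (Finset (Fin (d n))))
    (hcard : ∀ n, ∀ S ∈ 𝒮 n, S.card = K n)
    (hactive : ∀ n, ∀ S ∈ 𝒮 n, ∀ j, β n j ≠ 0 → j ∈ S)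
    (M C₁ C₂ ξ ξ' : ℝ) (hC₁ : 0 < C₁) (hξ : ξ < ξ')
    (hdesign : ∀ᶠ n in atTop, ∀ S ∈ 𝒮 n, DesignCondition (X n) S M C₁ C₂)
    (hpred : ∀ᶠ n in atTop, ∀ S ∈ 𝒮 n, ∀ i,
      |subRow (X n) S i ⬝ᵥ subVec (β n) S| < ξ)
    (hK : Tendsto (fun n : ℕ => (K n : ℝ) ^ 3 / (n : ℝ)) atTop (𝓝 0))
    (βhat : ∀ n, ∀ S : Finset (Fin (d n)), Ω n → (S → ℝ))
    (hmle : ∀ n, ∀ S ∈ 𝒮 n, ∀ ω,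
      (∃ b, IsMLE (X n) S ξ' (fun i => y n i ω) b) →
        IsMLE (X n) S ξ' (fun i => y n i ω) (βhat n S ω))
    (ε : ℝ) (hε : 0 < ε) :
    Tendsto (fun n => ⨆ S ∈ 𝒮 n,
        μ n {ω | ∃ η : S → ℝ, η ≠ 0 ∧
          ε < |stdError (X n) S (subVec (β n) S) η (βhat n S ω)
            - linTerm (X n) S (subVec (β n) S) η
                (fun i => y n i ω)|})
        atTop (𝓝 0) := by
  rw [ENNReal.tendsto_nhds_zero]
  intro τ hτ
  set δ : ℝ := (min τ 1).toReal with hδ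
  have hδτ : ENNReal.ofReal δ ≤ τ := by
    rw [hδ, ENNReal.ofReal_toReal (by simp)]
    exact min_le_left _ _
  have hδ0 : 0 < δ := ENNReal.toReal_pos (by simp [hτ.ne']) (by simp)
  -- outside an event of probability at most `δ`, the squared norm of the score is at most `L * K`
  set L : ℝ := (M ^ 2 + 1) / δ with hL
  have hL0 : 0 < L := by positivity
  have hML : M ^ 2 / L ≤ δ := by
    rw [div_le_iff₀ hL0, hL, mul_div_cancel₀ _ hδ0.ne']
    linarith
  have h2 := (tendsto_pow_div_of_cube hK (p := 2) (by norm_num) (by norm_num)).const_mul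
    (4 * L * M ^ 2 / (curvature ξ' * C₁) ^ 2)
  have h3 := (hK.sqrt).const_mul
    (4 * L * Real.sqrt (M ^ 2 * C₂ / curvature ξ') / (curvature ξ' * C₁) ^ 2)
  rw [mul_zero] at h2
  rw [Real.sqrt_zero, mul_zero] at h3
  have hξ2 : 0 < (ξ' - ξ) ^ 2 := pow_pos (sub_pos.2 hξ) 2
  filter_upwards [hdesign, hpred, h2.eventually (ge_mem_nhds hξ2),
    h3.eventually (ge_mem_nhds hε), eventually_gt_atTop 0] with n hd hp hsmall hrem hn
  refine iSup₂_le fun S hS => ?_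
  -- for empty `S` there is no `η ≠ 0`
  rcases Nat.eq_zero_or_pos S.card with h0 | h0
  · have : IsEmpty S := by
      rw [Finset.card_eq_zero] at h0
      subst h0
      infer_instance
    simp [Subsingleton.elim _ (0 : S → ℝ)]
  have hk : (S.card : ℝ) = K n := by rw [hcard n S hS]
  refine le_trans (measure_mono (t := {ω | L * S.card ≤
    score (X n) S (fun i => y n i ω) (subVec (β n) S) ⬝ᵥ
      score (X n) S (fun i => y n i ω) (subVec (β n) S)}) ?_) ?_
  · rintro ω ⟨η, hη, hlt⟩
    by_contra hcon
    rw [Set.mem_ofPred_eq] at hcon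
    have hs := (not_le.1 hcon).le
    have hex := exists_isMLE_of_score_le hn hC₁ hξ (hd S hS) (hp S hS) hs (by rwa [hk])
    have := (hmle n S hS ω hex).abs_stdError_sub_linTerm_le hn hC₁ (hd S hS)
      (fun i => (hp S hS i).trans hξ) hs hη
    rw [hk] at this
    linarith
  · rw [← ENNReal.ofReal_toReal (measure_ne_top (μ n) _)]
    refine le_trans (ENNReal.ofReal_le_ofReal ?_) hδτ
    exact ((hmodel n).measureReal_score_le (hd S hS) (hactive n S hS) hn h0 hL0).trans hML

/-- The standardized linear terms satisfy the central limit theorem. -/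
lemma tendsto_charFun_linTerm
    {Ω : ℕ → Type*} [∀ n, MeasurableSpace (Ω n)]
    (μ : ∀ n, Measure (Ω n)) [∀ n, IsProbabilityMeasure (μ n)]
    (d K : ℕ → ℕ)
    (X : ∀ n, Matrix (Fin n) (Fin (d n)) ℝ)
    (β : ∀ n, Fin (d n) → ℝ)
    (y : ∀ n, Fin n → Ω n → ℝ)
    (hmodel : ∀ n, IsLogisticModel (μ n) (X n) (β n) (y n))
    (S : ∀ n, Finset (Fin (d n)))
    (hcard : ∀ᶠ n in atTop, (S n).card = K n)
    (hactive : ∀ᶠ n in atTop, ∀ j, β n j ≠ 0 → j ∈ S n)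
    {M C₁ C₂ ξ : ℝ} (hC₁ : 0 < C₁)
    (hdesign : ∀ᶠ n in atTop, DesignCondition (X n) (S n) M C₁ C₂)
    (hpred : ∀ᶠ n in atTop, ∀ i, |subRow (X n) (S n) i ⬝ᵥ subVec (β n) (S n)| < ξ)
    (hK : Tendsto (fun n : ℕ => (K n : ℝ) ^ 3 / (n : ℝ)) atTop (𝓝 0))
    {η : ∀ n, S n → ℝ} (hη : ∀ᶠ n in atTop, η n ≠ 0) (t : ℝ) :
    Tendsto (fun n => charFun ((μ n).map fun ω =>
      linTerm (X n) (S n) (subVec (β n) (S n)) (η n) fun i => y n i ω) t)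
      atTop (𝓝 (charFun (gaussianReal 0 1) t)) := by
  have hg : charFun (gaussianReal 0 1) t = Complex.exp (-t ^ 2 / 2 : ℝ) := by
    rw [charFun_gaussianReal]
    congr 1
    push_cast
    ring
  rw [hg, tendsto_iff_norm_sub_tendsto_zero]
  set w : ℕ → ℝ := fun n =>
    |t| * Real.sqrt (M ^ 2 / (curvature ξ * C₁) * ((K n : ℝ) ^ 1 / n)) with hw
  have hw0 : Tendsto w atTop (𝓝 0) := by
    have := (((tendsto_pow_div_of_cube hK (p := 1) (by norm_num) (by norm_num)).const_mul
      (M ^ 2 / (curvature ξ * C₁))).sqrt).const_mul |t|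
    rwa [mul_zero, Real.sqrt_zero, mul_zero] at this
  have hw1 : Tendsto (fun n => 4 * w n * t ^ 2) atTop (𝓝 0) := by
    simpa using (hw0.const_mul 4).mul_const (t ^ 2)
  refine squeeze_zero' (Eventually.of_forall fun n => norm_nonneg _) ?_ hw1
  filter_upwards [hdesign, hpred, hcard, hactive, hη, hw0.eventually (ge_mem_nhds one_pos),
    eventually_gt_atTop 0] with n hd hp hk hS hηn hwn hn
  have hk' : ((S n).card : ℝ) = (K n : ℝ) ^ 1 := by rw [hk, pow_one]
  simp only [hw] at hwn ⊢
  rw [← hk'] at hwn ⊢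
  exact (hmodel n).norm_charFun_linTerm_sub_le hn hC₁ hd hS (fun i => (hp i).le) hηn hwn

end LogisticMLE

theorem theorem1
    {Ω : ℕ → Type*} [∀ n, MeasurableSpace (Ω n)]
    (μ : ∀ n, Measure (Ω n)) [∀ n, IsProbabilityMeasure (μ n)]
    (d K : ℕ → ℕ)
    (X : ∀ n, Matrix (Fin n) (Fin (d n)) ℝ)
    (β : ∀ n, Fin (d n) → ℝ)
    (y : ∀ n, Fin n → Ω n → ℝ)
    (hmodel : ∀ n, LogisticMLE.IsLogisticModel (μ n) (X n) (β n) (y n))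
    -- the submodels under consideration: size `K n`, containing the true active set
    (𝒮 : ∀ n, Set (Finset (Fin (d n))))
    (hcard : ∀ n, ∀ S ∈ 𝒮 n, S.card = K n)
    (hactive : ∀ n, ∀ S ∈ 𝒮 n, ∀ j, β n j ≠ 0 → j ∈ S)
    (M C₁ C₂ ξ ξ' : ℝ) (hC₁ : 0 < C₁) (hξ : ξ < ξ')
    (hdesign : ∀ᶠ n in atTop, ∀ S ∈ 𝒮 n, LogisticMLE.DesignCondition (X n) S M C₁ C₂)
    (hpred : ∀ᶠ n in atTop, ∀ S ∈ 𝒮 n, ∀ i,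
      |LogisticMLE.subRow (X n) S i ⬝ᵥ LogisticMLE.subVec (β n) S| < ξ)
    (hK : Tendsto (fun n : ℕ => (K n : ℝ) ^ 3 / (n : ℝ)) atTop (𝓝 0))
    -- the estimator is a maximizer of the likelihood whenever there is one
    (βhat : ∀ n, ∀ S : Finset (Fin (d n)), Ω n → (S → ℝ))
    (hmeas : ∀ n S, Measurable (βhat n S))
    (hmle : ∀ n, ∀ S ∈ 𝒮 n, ∀ ω,
      (∃ b, LogisticMLE.IsMLE (X n) S ξ' (fun i => y n i ω) b) →
        LogisticMLE.IsMLE (X n) S ξ' (fun i => y n i ω) (βhat n S ω)) :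
    (∀ ε : ℝ, 0 < ε →
      Tendsto (fun n => ⨆ S ∈ 𝒮 n,
        μ n {ω | ∃ η : S → ℝ, η ≠ 0 ∧
          ε < |LogisticMLE.stdError (X n) S (LogisticMLE.subVec (β n) S) η (βhat n S ω)
            - LogisticMLE.linTerm (X n) S (LogisticMLE.subVec (β n) S) η
                (fun i => y n i ω)|})
        atTop (𝓝 0)) ∧
    (∀ S : ∀ n, Finset (Fin (d n)), (∀ᶠ n in atTop, S n ∈ 𝒮 n) →
      ∀ η : ∀ n, S n → ℝ, (∀ᶠ n in atTop, η n ≠ 0) →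
        TendstoInDistribution
          (fun n ω => LogisticMLE.stdError (X n) (S n) (LogisticMLE.subVec (β n) (S n)) (η n)
            (βhat n (S n) ω))
          atTop (id : ℝ → ℝ) μ (gaussianReal 0 1)) := by
  have hrem := LogisticMLE.tendsto_iSup_measure_remainder μ d K X β y hmodel 𝒮 hcard hactive
    M C₁ C₂ ξ ξ' hC₁ hξ hdesign hpred hK βhat hmle
  refine ⟨hrem, fun S hS η hη => ?_⟩
  refine LogisticMLE.tendstoInDistribution_of_charFun_of_sub
    (B := fun n ω => LogisticMLE.linTerm (X n) (S n) (LogisticMLE.subVec (β n) (S n)) (η n)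
      fun i => y n i ω)
    (fun n => (LogisticMLE.measurable_stdError _ _ _ _).comp (hmeas n (S n)))
    (fun n => LogisticMLE.measurable_linTerm (hmodel n) _ _) (fun ε hε => ?_)
    (LogisticMLE.tendsto_charFun_linTerm (M := M) (C₂ := C₂) (ξ := ξ) μ d K X β y hmodel S
      ?_ ?_ hC₁ ?_ ?_ hK hη)
  · refine tendsto_of_tendsto_of_tendsto_of_le_of_le' tendsto_const_nhds (hrem ε hε)
      (Eventually.of_forall fun n => zero_le) ?_
    filter_upwards [hS, hη] with n hSn hηn
    refine le_trans (measure_mono fun ω hω => ?_)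
      (le_iSup₂ (f := fun S (_ : S ∈ 𝒮 n) => μ n {ω | ∃ η : S → ℝ, η ≠ 0 ∧
        ε < |LogisticMLE.stdError (X n) S (LogisticMLE.subVec (β n) S) η (βhat n S ω)
          - LogisticMLE.linTerm (X n) S (LogisticMLE.subVec (β n) S) η (fun i => y n i ω)|})
        (S n) hSn)
    exact ⟨η n, hηn, hω⟩
  · exact hS.mono fun n hSn => hcard n _ hSn
  · exact hS.mono fun n hSn => hactive n _ hSn
  · exact (hdesign.and hS).mono fun n h => h.1 _ h.2
  · exact (hpred.and hS).mono fun n h => h.1 _ h.2
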